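/- Conventions. For a commutative ring $B$, the real spectrum $\mathrm{Spec}_r B$ is the set of pairs $\alpha=(\mathfrak q,\le_\alpha)$, where $\mathfrak q$ is a prime ideal of $B$ and $\le_\alpha$ is an ordering of $B/\mathfrak q$; an element $b\in B$ is called positive on $\mathrm{Spec}_r B$ if its class satisfies $b\ge_\alpha 0$ for every $\alpha\in\mathrm{Spec}_r B$ (this is vacuous if $\mathrm{Spec}_r B=\emptyset$). A prime ideal $\mathfrak q$ of $B$ is real if $-1$ is not a sum of squares in $B/\mathfrak q$. A symmetric matrix $M$ over $B$ is positive semidefinite on $\mathrm{Spec}_r B$ if for every ring homomorphism $\varphi:B\to R$ into a real closed field $R$ the matrix $\varphi(M)$ is positive semidefinite. For a square matrix $M$, $\mathfrak d_k(M)$ denotes the ideal generated by the $k\times k$ minors of $M$. A Dedekind domain $A$ satisfies (PNRI) if, for every $f\in A$ such that no minimal prime ideal over $(f)$ is real, $f$ is associated in $A$ to an element that is positive on $\mathrm{Spec}_r A$. Theorem. Let $A$ be a Dedekind domain (fields allowed) satisfying (PNRI), and let $M\in A^{n\times n}$ be a symmetric matrix that is positive semidefinite on $\mathrm{Spec}_r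 A$. Suppose that for every $k=1,\dots,n$ the ideal $\mathfrak d_k(M)$ is principal, $\mathfrak d_k(M)=(d_k)$ with $d_k\in A$. Then for every prime ideal $\mathfrak p$ of $A$ and every $k=1,\dots,n$, the element $d_k$ is associated in the localization $A_{\mathfrak p}$ to an element $d'_k\in A_{\mathfrak p}$ that is positive on $\mathrm{Spec}_r A_{\mathfrak p}$ and is the image of an element of $A$ that is positive on $\mathrm{Spec}_r A$. -/

import Mathlib

universe u

/-- The real spectrum of a commutative ring `A`. A pair `(𝔭, ≤)` consisting of a prime ideal and
an ordering of `A ⧸ 𝔭` is recorded as the set of elements of `A` whose class is nonnegative; its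
support is `𝔭`. -/
abbrev RealSpectrum (A : Type u) [CommRing A] : Type u :=
  {P : RingPreordering A // P.IsOrdering}

/-- `a ≥ 0` at every point of the real spectrum of `A`. -/
def NonnegOnRealSpectrum {A : Type u} [CommRing A] (a : A) : Prop :=
  ∀ α : RealSpectrum A, a ∈ α.1

/-- `φ(M)` is positive semidefinite for every morphism `φ` from `A` to a real closed field.
(Fields in the universe of `A` suffice: they include the real closures of the ordered residue
fields of `A`.) -/
def PsdOnRealSpectrum {A : Type u} [CommRing A] {n : ℕ} (M : Matrix (Fin n) (Fin n) A) : Prop :=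
  ∀ (R : Type u) [Field R] [LinearOrder R] [IsStrictOrderedRing R] [IsRealClosed R]
    (φ : A →+* R) (x : Fin n → R), 0 ≤ x ⬝ᵥ (M.map φ).mulVec x

/-- An ideal is real prime if it is prime and `-1` is not a sum of squares in the quotient. -/
def IsRealPrime {A : Type u} [CommRing A] (𝔭 : Ideal A) : Prop :=
  𝔭.IsPrime ∧ IsSemireal (A ⧸ 𝔭)

/-- The condition (PNRI) for Dedekind domains: if no minimal prime of the principal ideal `(f)`
is real, then `f` is associated to an element that is positive on the real spectrum. -/
def PNRI (A : Type u) [CommRing A] : Prop :=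
  ∀ f : A, (∀ 𝔮 ∈ (Ideal.span {f}).minimalPrimes, ¬ IsRealPrime 𝔮) →
    ∃ g : A, Associated f g ∧ NonnegOnRealSpectrum g

/-- The ideal generated by the minors of order `k` of `M`. -/
def minorIdeal {A : Type u} [CommRing A] {n : ℕ} (M : Matrix (Fin n) (Fin n) A) (k : ℕ) :
    Ideal A :=
  Ideal.span {a | ∃ r c : Fin k ↪o Fin n, a = (M.submatrix r c).det}

/-!
Let `B` be the localization at `𝔭`, a valuation ring of dimension at most one.

If the residue field of `B` is real, then `2` is a unit of `B`, so by polarization `𝔡ₖ(M)` is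
generated over `B` by the values of the quadratic form of the `k`-th compound matrix of `M`; since
`B` is local, `dₖ` is associated to one of these values. Cauchy–Binet shows that the compound matrix
of a positive semidefinite matrix is positive semidefinite, so by Artin–Schreier theory the value is
a sum of squares in the fraction field of `B`. As sums `1 + ∑ bᵢ²` are units of `B`, a sum of
squares is a unit times a square.

If the residue field is not real, every `x` in the ring is associated over `B` to a positive
element: there are `c ∉ 𝔭` and a sum of squares `t` such that `c² + t` lies in `𝔭`, hence, after
passing to a power, in `x𝔭B`, and `c² x + (c² + t)(x² + 1)` is such an element.
-/

section SumsOfSquares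

variable {R S F : Type*} [CommRing R] [CommRing S] [Field F]

theorem isSumSq_map (f : R →+* S) {s : R} (hs : IsSumSq s) : IsSumSq (f s) := by
  induction hs with
  | zero => simp
  | sq_add a _ ih => simpa using ih.sq_add (f a)

theorem exists_isSumSq_of_surjective {f : R →+* S} (hf : Function.Surjective f) {s : S}
    (hs : IsSumSq s) : ∃ t, IsSumSq t ∧ f t = s := by
  induction hs with
  | zero => exact ⟨0, .zero, map_zero f⟩
  | sq_add a _ ih =>
    obtain ⟨t, ht, rfl⟩ := ih
    obtain ⟨b, rfl⟩ := hf a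
    exact ⟨b * b + t, ht.sq_add b, by simp⟩

theorem isSemireal_of_ringHom (f : R →+* S) [IsSemireal S] : IsSemireal R where
  one_add_ne_zero hs h :=
    IsSemireal.one_add_ne_zero (isSumSq_map f hs) (by simpa using congrArg f h)

theorem isSumSq_div {s t : F} (hs : IsSumSq s) (ht : IsSumSq t) : IsSumSq (s / t) := by
  rcases eq_or_ne t 0 with rfl | ht0
  · simp
  · have h : s / t = s * t * (t⁻¹ * t⁻¹) := by field_simp
    exact h ▸ (hs.mul ht).mul (.mul_self _)

theorem isFormallyReal_of_isSemireal (F : Type*) [Field F] [IsSemireal F] : IsFormallyReal F := by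
  refine .of_eq_zero_of_mul_self_of_eq_zero_of_add mul_self_eq_zero.mp fun {s t} hs ht h ↦ ?_
  by_contra hs0
  refine IsSemireal.one_add_ne_zero (isSumSq_div ht hs) ?_
  rw [one_add_div hs0, h, zero_div]

theorem isSemireal_of_not_isSumSq (h2 : (2 : F) ≠ 0) {a : F} (ha : ¬ IsSumSq a) :
    IsSemireal F := by
  refine .of_not_isSumSq_neg_one fun h ↦ ha ?_
  have key : a = (a + 1) / 2 * ((a + 1) / 2) + -1 * ((a - 1) / 2 * ((a - 1) / 2)) := by
    field_simp
    ring
  exact key ▸ (IsSumSq.mul_self _).add (h.mul (.mul_self _))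

end SumsOfSquares

section QuadraticExtension

variable {F : Type*} [Field F] {x : F}

theorem exists_re_eq_add_mul_of_isSumSq {y : QuadraticAlgebra F x 0} (hy : IsSumSq y) :
    ∃ s t : F, IsSumSq s ∧ IsSumSq t ∧ y.re = s + x * t := by
  induction hy with
  | zero => exact ⟨0, 0, .zero, .zero, by simp⟩
  | sq_add a _ ih =>
    obtain ⟨s, t, hs, ht, h⟩ := ih
    refine ⟨a.re * a.re + s, a.im * a.im + t, hs.sq_add _, ht.sq_add _, ?_⟩
    rw [QuadraticAlgebra.re_add, QuadraticAlgebra.re_mul, h]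
    ring

theorem isSemireal_quadraticAlgebra [IsSemireal F] (hx : ¬ IsSumSq (-x)) :
    IsSemireal (QuadraticAlgebra F x 0) := by
  refine .of_not_isSumSq_neg_one fun h ↦ hx ?_
  obtain ⟨s, t, hs, ht, hst⟩ := exists_re_eq_add_mul_of_isSumSq h
  rw [QuadraticAlgebra.re_neg, QuadraticAlgebra.re_one] at hst
  have h1 : -x * t = 1 + s := by linear_combination hst
  have ht0 : t ≠ 0 := by
    rintro rfl
    exact IsSemireal.one_add_ne_zero hs (by rw [← h1, mul_zero])
  rw [eq_div_of_mul_eq ht0 h1]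
  exact isSumSq_div (IsSumSq.one.add hs) ht

end QuadraticExtension

section OddDegreeExtension

open Polynomial

theorem even_natDegree_and_isSumSq_leadingCoeff {R : Type*} [CommRing R] [IsDomain R]
    [IsFormallyReal R] {s : R[X]} (hs : IsSumSq s) :
    Even s.natDegree ∧ IsSumSq s.leadingCoeff := by
  induction hs with
  | zero => simp
  | @sq_add a s _ ih =>
    rcases eq_or_ne a 0 with rfl | ha
    · simpa using ih
    have hsq : Even (a * a).natDegree ∧ IsSumSq (a * a).leadingCoeff := by
      rw [natDegree_mul ha ha, leadingCoeff_mul]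
      exact ⟨⟨_, rfl⟩, .mul_self _⟩
    rcases lt_trichotomy (a * a).degree s.degree with h | h | h
    · rwa [natDegree_add_eq_right_of_degree_lt h, leadingCoeff_add_of_degree_lt h]
    · have hlead : (a * a).leadingCoeff + s.leadingCoeff ≠ 0 := fun h0 ↦
        mul_ne_zero ha ha <| leadingCoeff_eq_zero.mp <|
          IsFormallyReal.eq_zero_of_add_right hsq.2 ih.2 h0
      have hdeg : (a * a + s).degree = s.degree := by
        rw [degree_add_eq_of_leadingCoeff_add_ne_zero hlead, h, max_self]
      rw [natDegree_eq_of_degree_eq hdeg, leadingCoeff_add_of_degree_eq h hlead]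
      exact ⟨ih.1, hsq.2.add ih.2⟩
    · rwa [natDegree_add_eq_left_of_degree_lt h, leadingCoeff_add_of_degree_lt' h]

variable {F : Type*} [Field F]

theorem exists_isSumSq_mk_eq_natDegree_le {p : F[X]} (hp : p.natDegree ≠ 0) {y : AdjoinRoot p}
    (hy : IsSumSq y) :
    ∃ t : F[X], IsSumSq t ∧ AdjoinRoot.mk p t = y ∧ t.natDegree + 2 ≤ 2 * p.natDegree := by
  induction hy with
  | zero => exact ⟨0, .zero, map_zero _, by simp only [natDegree_zero]; lia⟩
  | sq_add a _ ih =>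
    obtain ⟨t, ht, rfl, hdeg⟩ := ih
    obtain ⟨b, rfl⟩ := AdjoinRoot.mk_surjective a
    have hb : AdjoinRoot.mk p (b % p) = AdjoinRoot.mk p b :=
      AdjoinRoot.mk_eq_mk.mpr ⟨-(b / p), by linear_combination EuclideanDomain.div_add_mod b p⟩
    refine ⟨b % p * (b % p) + t, ht.sq_add _, by rw [map_add, map_mul, hb], ?_⟩
    have hlt : (b % p).natDegree < p.natDegree := natDegree_mod_lt b hp
    have hsq : (b % p * (b % p)).natDegree ≤ _ := natDegree_mul_le
    have hsum := natDegree_add_le (b % p * (b % p)) t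
    lia

/-- If `-1` were a sum of squares modulo `p`, then `p * q = 1 + t` for a sum of squares `t` of
small degree, and `q` would be a counterexample of smaller odd degree. -/
theorem isSemireal_adjoinRoot_of_odd_natDegree [IsSemireal F] {p : F[X]}
    (hp : Odd p.natDegree) : IsSemireal (AdjoinRoot p) := by
  induction hn : p.natDegree using Nat.strong_induction_on generalizing p with
  | _ n ih =>
    subst hn
    have := isFormallyReal_of_isSemireal F
    refine .of_not_isSumSq_neg_one fun h ↦ ?_
    obtain ⟨t, ht, hmk, hdeg⟩ := exists_isSumSq_mk_eq_natDegree_le hp.pos.ne' h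
    have hpt : p ∣ 1 + t := by rw [← AdjoinRoot.mk_eq_zero, map_add, map_one, hmk, add_neg_cancel]
    obtain ⟨q, hq⟩ := hpt
    have h1t : 1 + t ≠ 0 := fun h0 ↦ IsSemireal.one_add_ne_zero
      (isSumSq_map (evalRingHom 0) ht) (by simpa using congrArg (eval 0) h0)
    have hpq : (1 + t).natDegree = p.natDegree + q.natDegree := by
      rw [hq] at h1t ⊢
      exact natDegree_mul (left_ne_zero_of_mul h1t) (right_ne_zero_of_mul h1t)
    have hle : (1 + t).natDegree ≤ max (1 : F[X]).natDegree t.natDegree := natDegree_add_le _ _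
    have heven := (even_natDegree_and_isSumSq_leadingCoeff (IsSumSq.one.add ht)).1
    have hodd : Odd q.natDegree := by grind
    have := ih q.natDegree (by simp only [natDegree_one] at hle; lia) hodd rfl
    refine IsSemireal.not_isSumSq_neg_one (AdjoinRoot q) ?_
    have hqt : AdjoinRoot.mk q t = -1 := by
      rw [eq_neg_iff_add_eq_zero, add_comm, ← map_one (AdjoinRoot.mk q), ← map_add, hq,
        AdjoinRoot.mk_eq_zero]
      exact dvd_mul_left q p
    exact hqt ▸ isSumSq_map _ ht

theorem exists_irreducible_dvd_of_odd_natDegree {p : F[X]} (hp : Odd p.natDegree) :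
    ∃ q, Irreducible q ∧ Odd q.natDegree ∧ q ∣ p := by
  have hp0 : p ≠ 0 := by
    rintro rfl
    simp at hp
  induction p using WfDvdMonoid.induction_on_irreducible with
  | zero => exact absurd rfl hp0
  | unit u hu => simp [natDegree_eq_zero_of_isUnit hu] at hp
  | mul p q hp0' hq ih =>
    by_cases hodd : Odd q.natDegree
    · exact ⟨q, hq, hodd, dvd_mul_right _ _⟩
    · rw [natDegree_mul hq.ne_zero hp0'] at hp
      obtain ⟨r, hr, hrodd, hrp⟩ := ih (by grind) hp0'
      exact ⟨r, hr, hrodd, hrp.mul_left q⟩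

end OddDegreeExtension

section RealClosure

open Polynomial

theorem isSumSq_neg_of_not_isSquare {F : Type u} [Field F] [IsSemireal F]
    (hF : ∀ (E : Type u) [Field E] [Algebra F E] [Algebra.IsAlgebraic F E] [IsSemireal E],
      Function.Surjective (algebraMap F E)) {x : F} (hx : ¬ IsSquare x) : IsSumSq (-x) := by
  by_contra hneg
  have := isSemireal_quadraticAlgebra hneg
  have : Fact (∀ r, r ^ 2 ≠ x + 0 * r) :=
    ⟨fun r hr ↦ hx ⟨r, by linear_combination -hr⟩⟩
  obtain ⟨r, hr⟩ := hF (QuadraticAlgebra F x 0) ⟨0, 1⟩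
  simpa using congrArg QuadraticAlgebra.im hr

theorem isRealClosed_of_forall_surjective {F : Type u} [Field F] [IsSemireal F]
    (hF : ∀ (E : Type u) [Field E] [Algebra F E] [Algebra.IsAlgebraic F E] [IsSemireal E],
      Function.Surjective (algebraMap F E)) : IsRealClosed F where
  one_add_ne_zero := IsSemireal.one_add_ne_zero
  isSquare_or_isSquare_neg x := by
    by_contra! h
    have := isFormallyReal_of_isSemireal F
    have hneg : IsSumSq (-x) := isSumSq_neg_of_not_isSquare hF h.1
    have hpos : IsSumSq x := neg_neg x ▸ isSumSq_neg_of_not_isSquare hF h.2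
    have hx : x = 0 := IsFormallyReal.eq_zero_of_isSumSq_of_neg_isSumSq hpos hneg
    exact h.1 (hx ▸ IsSquare.zero)
  exists_isRoot_of_odd_natDegree {f} hf := by
    obtain ⟨p, hp, hodd, hpf⟩ := exists_irreducible_dvd_of_odd_natDegree hf
    have : Fact (Irreducible p) := ⟨hp⟩
    have := isSemireal_adjoinRoot_of_odd_natDegree hodd
    have : Module.Finite F (AdjoinRoot p) := (AdjoinRoot.powerBasis hp.ne_zero).finite
    obtain ⟨r, hr⟩ := hF (AdjoinRoot p) (AdjoinRoot.root p)
    refine ⟨r, IsRoot.dvd ?_ hpf⟩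
    have hroot : algebraMap F (AdjoinRoot p) (eval r p) = 0 := by
      rw [← aeval_algebraMap_apply_eq_algebraMap_eval, hr, aeval_def, AdjoinRoot.algebraMap_eq]
      exact AdjoinRoot.eval₂_root p
    exact (map_eq_zero _).mp hroot

theorem exists_isSumSq_coe_eq_of_directedOn {K : Type*} [Field K] {C : Set (Subfield K)}
    (hne : C.Nonempty) (hC : DirectedOn (· ≤ ·) C) {s : (sSup C : Subfield K)} (hs : IsSumSq s) :
    ∃ L ∈ C, ∃ t : L, IsSumSq t ∧ (t : K) = s := by
  induction hs with
  | zero => exact hne.imp fun L hL ↦ ⟨hL, 0, .zero, rfl⟩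
  | sq_add a _ ih =>
    obtain ⟨L₁, hL₁, t, ht, hts⟩ := ih
    obtain ⟨L₂, hL₂, ha⟩ := (Subfield.mem_sSup_of_directedOn hne hC).mp a.2
    obtain ⟨L, hL, h₁, h₂⟩ := hC L₁ hL₁ L₂ hL₂
    refine ⟨L, hL, ⟨a, h₂ ha⟩ * ⟨a, h₂ ha⟩ + Subfield.inclusion h₁ t,
      (isSumSq_map _ ht).sq_add _, ?_⟩
    rw [Subfield.coe_add, Subfield.coe_add, ← hts]
    rfl

theorem isSemireal_sSup_of_directedOn {K : Type*} [Field K] {C : Set (Subfield K)}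
    (hne : C.Nonempty) (hC : DirectedOn (· ≤ ·) C) (hreal : ∀ L ∈ C, IsSemireal L) :
    IsSemireal (sSup C : Subfield K) where
  one_add_ne_zero hs h := by
    obtain ⟨L, hL, t, ht, hts⟩ := exists_isSumSq_coe_eq_of_directedOn hne hC hs
    have := hreal L hL
    refine IsSemireal.one_add_ne_zero ht (Subtype.ext ?_)
    simpa [hts] using congrArg Subtype.val h

theorem exists_le_maximal_isSemireal {K : Type*} [Field K] (L₀ : Subfield K) [IsSemireal L₀] :
    ∃ L, L₀ ≤ L ∧ Maximal (fun L : Subfield K ↦ IsSemireal L) L :=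
  zorn_le_nonempty₀ {L : Subfield K | IsSemireal L}
    (fun C hC hchain L hL ↦ ⟨sSup C,
      isSemireal_sSup_of_directedOn ⟨L, hL⟩ hchain.directedOn hC, fun _ ↦ le_sSup⟩)
    L₀ ‹_›

theorem algebraMap_surjective_of_maximal_isSemireal {Ω E : Type*} [Field Ω] [IsAlgClosed Ω]
    {L : Subfield Ω} (hL : Maximal (fun L : Subfield Ω ↦ IsSemireal L) L) [Field E] [Algebra L E]
    [Algebra.IsAlgebraic L E] [IsSemireal E] : Function.Surjective (algebraMap L E) := by
  intro y
  let ψ : E →ₐ[L] Ω := IsAlgClosed.lift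
  have hreal : IsSemireal ψ.toRingHom.fieldRange :=
    isSemireal_of_ringHom ψ.toRingHom.rangeRestrictFieldEquiv.symm.toRingHom
  have hle : L ≤ ψ.toRingHom.fieldRange := fun z hz ↦ ⟨algebraMap L E ⟨z, hz⟩, ψ.commutes _⟩
  have hy : ψ y ∈ L := hL.le_of_ge hreal hle ⟨y, rfl⟩
  exact ⟨⟨ψ y, hy⟩, ψ.injective (ψ.commutes _)⟩

theorem exists_linearOrder_of_isRealClosed (R : Type*) [Field R] [IsRealClosed R] :
    ∃ _ : LinearOrder R, IsStrictOrderedRing R := by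
  classical
  have := isFormallyReal_of_isSemireal R
  let C : RingCone R :=
    { Subsemiring.sumSq R with
      eq_zero_of_mem_of_neg_mem' := fun {a} ha hna ↦
        IsFormallyReal.eq_zero_of_isSumSq_of_neg_isSumSq
          (Subsemiring.mem_sumSq.mp ha) (Subsemiring.mem_sumSq.mp hna) }
  have hC {a : R} (ha : IsSquare a) : a ∈ C := Subsemiring.mem_sumSq.mpr ha.isSumSq
  have : HasMemOrNegMem C := ⟨fun a ↦ (IsRealClosed.isSquare_or_isSquare_neg a).imp hC hC⟩
  let : LinearOrder R := LinearOrder.mkOfAddGroupCone C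
  have : IsOrderedRing R := IsOrderedRing.mkOfCone C
  exact ⟨inferInstance, IsOrderedRing.toIsStrictOrderedRing R⟩

theorem exists_ringHom_isRealClosed (K : Type u) [Field K] [IsSemireal K] :
    ∃ (R : Type u) (_ : Field R) (_ : LinearOrder R) (_ : IsStrictOrderedRing R),
      IsRealClosed R ∧ Nonempty (K →+* R) := by
  let ι : K →+* AlgebraicClosure K := algebraMap K _
  have : IsSemireal ι.fieldRange := isSemireal_of_ringHom ι.rangeRestrictFieldEquiv.symm.toRingHom
  obtain ⟨L, hle, hL⟩ := exists_le_maximal_isSemireal ι.fieldRange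
  have : IsSemireal L := hL.prop
  have : IsRealClosed L :=
    isRealClosed_of_forall_surjective fun _ ↦ algebraMap_surjective_of_maximal_isSemireal hL
  obtain ⟨_, _⟩ := exists_linearOrder_of_isRealClosed L
  exact ⟨L, inferInstance, ‹_›, ‹_›, this,
    ⟨(Subfield.inclusion hle).comp ι.rangeRestrictField⟩⟩

theorem exists_isSemireal_isSquare_neg {K : Type u} [Field K] (h2 : (2 : K) ≠ 0) {a : K}
    (ha : ¬ IsSumSq a) :
    ∃ (E : Type u) (_ : Field E) (φ : K →+* E), IsSemireal E ∧ IsSquare (φ (-a)) := by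
  have := isSemireal_of_not_isSumSq h2 ha
  by_cases hsq : IsSquare (-a)
  · exact ⟨K, inferInstance, RingHom.id K, this, hsq⟩
  have : Fact (∀ r, r ^ 2 ≠ -a + 0 * r) := ⟨fun r hr ↦ hsq ⟨r, by linear_combination -hr⟩⟩
  refine ⟨QuadraticAlgebra K (-a) 0, inferInstance, algebraMap K _,
    isSemireal_quadraticAlgebra (by rwa [neg_neg]), ⟨0, 1⟩, ?_⟩
  ext <;> simp

theorem exists_isRealClosed_neg_of_not_isSumSq {K : Type u} [Field K] (h2 : (2 : K) ≠ 0) {a : K}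
    (ha : ¬ IsSumSq a) :
    ∃ (R : Type u) (_ : Field R) (_ : LinearOrder R) (_ : IsStrictOrderedRing R),
      IsRealClosed R ∧ ∃ φ : K →+* R, φ a < 0 := by
  obtain ⟨E, _, φ, _, hsq⟩ := exists_isSemireal_isSquare_neg h2 ha
  obtain ⟨R, _, _, _, hR, ⟨ψ⟩⟩ := exists_ringHom_isRealClosed E
  refine ⟨R, ‹_›, ‹_›, ‹_›, hR, ψ.comp φ, lt_of_le_of_ne ?_ ?_⟩
  · have hnonneg : 0 ≤ ψ (φ (-a)) := (hsq.map ψ).nonneg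
    rwa [map_neg, map_neg, neg_nonneg] at hnonneg
  · rw [Ne, map_eq_zero]
    rintro rfl
    exact ha .zero

end RealClosure

/-- Nonnegativity under every morphism to a real closed field: the scalar counterpart of
`PsdOnRealSpectrum`, with the same restriction on universes. -/
def NonnegOnRealClosedFields {B : Type u} [CommRing B] (b : B) : Prop :=
  ∀ (R : Type u) [Field R] [LinearOrder R] [IsStrictOrderedRing R] [IsRealClosed R]
    (φ : B →+* R), 0 ≤ φ b

section ValuationRing

open IsLocalRing

theorem isUnit_one_add_of_isSumSq {B : Type*} [CommRing B] [IsLocalRing B]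
    [IsSemireal (ResidueField B)] {t : B} (ht : IsSumSq t) : IsUnit (1 + t) := by
  rw [← residue_ne_zero_iff_isUnit, map_add, map_one]
  exact IsSemireal.one_add_ne_zero (isSumSq_map _ ht)

theorem isUnit_two {B : Type*} [CommRing B] [IsLocalRing B] [IsSemireal (ResidueField B)] :
    IsUnit (2 : B) :=
  one_add_one_eq_two (R := B) ▸ isUnit_one_add_of_isSumSq IsSumSq.one

variable {B : Type*} [CommRing B] [IsDomain B] [ValuationRing B]

theorem exists_eq_mul_algebraMap_or {K : Type*} [Field K] [Algebra B K] [IsFractionRing B K]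
    (a c : K) : ∃ b : B, a = c * algebraMap B K b ∨ c = a * algebraMap B K b := by
  rcases eq_or_ne a 0 with rfl | ha
  · exact ⟨0, .inl (by simp)⟩
  rcases eq_or_ne c 0 with rfl | hc
  · exact ⟨0, .inr (by simp)⟩
  rcases ValuationRing.isInteger_or_isInteger B (a / c) with ⟨b, hb⟩ | ⟨b, hb⟩
  · exact ⟨b, .inl (by rw [hb, mul_div_cancel₀ _ hc])⟩
  · exact ⟨b, .inr (by rw [hb, inv_div, mul_div_cancel₀ _ ha])⟩

/-- Pull out the square of largest valuation. -/
theorem exists_eq_mul_self_mul_one_add_of_isSumSq {K : Type*} [Field K] [Algebra B K]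
    [IsFractionRing B K] {y : K} (hy : IsSumSq y) :
    ∃ (c : K) (t : B), IsSumSq t ∧ y = c * c * algebraMap B K (1 + t) := by
  induction hy with
  | zero => exact ⟨0, 0, .zero, by simp⟩
  | sq_add a _ ih =>
    obtain ⟨c, t, ht, rfl⟩ := ih
    rcases exists_eq_mul_algebraMap_or (B := B) a c with ⟨b, rfl | rfl⟩
    · refine ⟨c, b * b + t, ht.sq_add b, ?_⟩
      simp only [map_add, map_mul, map_one]
      ring
    · refine ⟨a, b * b * (1 + t), (IsSumSq.mul_self b).mul (IsSumSq.one.add ht), ?_⟩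
      simp only [map_add, map_mul, map_one]
      ring

theorem exists_associated_mul_self_of_isSumSq [IsSemireal (ResidueField B)] {K : Type*} [Field K]
    [Algebra B K] [IsFractionRing B K] {x : B} (hx : IsSumSq (algebraMap B K x)) :
    ∃ c : B, Associated x (c * c) := by
  obtain ⟨c, t, ht, hc⟩ := exists_eq_mul_self_mul_one_add_of_isSumSq (B := B) hx
  obtain ⟨u, hu⟩ := isUnit_one_add_of_isSumSq ht
  have hcc : c * c = algebraMap B K (x * ↑u⁻¹) := by
    rw [map_mul, hc, ← hu, mul_assoc, ← map_mul, Units.mul_inv, map_one, mul_one]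
  have hint : IsIntegral B c := .of_pow two_pos (by rw [pow_two, hcc]; exact isIntegral_algebraMap)
  obtain ⟨b, rfl⟩ := IsIntegrallyClosed.isIntegral_iff.mp hint
  exact ⟨b, u⁻¹, FaithfulSMul.algebraMap_injective B K (by rw [← hcc, map_mul])⟩

theorem NonnegOnRealClosedFields.exists_associated_mul_self {B : Type u} [CommRing B] [IsDomain B]
    [ValuationRing B] [IsSemireal (ResidueField B)] {x : B} (hx : NonnegOnRealClosedFields x) :
    ∃ c : B, Associated x (c * c) := by
  suffices h : IsSumSq (algebraMap B (FractionRing B) x) from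
    exists_associated_mul_self_of_isSumSq h
  by_contra h
  have h2 : (2 : FractionRing B) ≠ 0 := by
    simpa only [map_ofNat] using (isUnit_two.map (algebraMap B (FractionRing B))).ne_zero
  obtain ⟨R, _, _, _, _, φ, hφ⟩ := exists_isRealClosed_neg_of_not_isSumSq h2 h
  exact hφ.not_ge (hx R (φ.comp (algebraMap B _)))

end ValuationRing

section CompoundMatrix

open Matrix

noncomputable instance fintypeOrderEmbedding {α β : Type*} [LE α] [LE β] [Finite α] [Finite β] :
    Fintype (α ↪o β) :=
  have : Finite (α ↪o β) := DFunLike.finite _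
  Fintype.ofFinite _

variable {R S l m n : Type*} [CommRing R] [CommRing S]

/-- The `k`-th compound matrix of `M`, whose entries are the minors of order `k` of `M`, indexed by
the increasing sequences of row and column indices. -/
def compoundMatrix [Preorder m] [Preorder n] (k : ℕ) (M : Matrix m n R) :
    Matrix (Fin k ↪o m) (Fin k ↪o n) R :=
  of fun r c ↦ (M.submatrix r c).det

theorem compoundMatrix_apply [Preorder m] [Preorder n] (k : ℕ) (M : Matrix m n R)
    (r : Fin k ↪o m) (c : Fin k ↪o n) : compoundMatrix k M r c = (M.submatrix r c).det :=
  rfl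

theorem compoundMatrix_transpose [Preorder m] [Preorder n] (k : ℕ) (M : Matrix m n R) :
    compoundMatrix k Mᵀ = (compoundMatrix k M)ᵀ := by
  ext r c
  exact det_transpose (M.submatrix c r)

theorem compoundMatrix_map [Preorder m] [Preorder n] (k : ℕ) (M : Matrix m n R) (f : R →+* S) :
    compoundMatrix k (M.map f) = (compoundMatrix k M).map f := by
  ext r c
  exact (f.map_det (M.submatrix r c)).symm

theorem compoundMatrix_mul_diagonal_apply [Preorder m] [Preorder n] [Fintype n] [DecidableEq n]
    (k : ℕ) (M : Matrix m n R) (d : n → R) (r : Fin k ↪o m) (c : Fin k ↪o n) :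
    compoundMatrix k (M * diagonal d) r c = (∏ i, d (c i)) * compoundMatrix k M r c := by
  rw [compoundMatrix_apply, compoundMatrix_apply, ← det_mul_row]
  congr 1
  ext i j
  simp only [submatrix_apply, mul_diagonal, of_apply, mul_comm]

theorem sum_eq_sum_orderEmbedding_sum_perm {N : Type*} [AddCommMonoid N] [LinearOrder m]
    [Fintype m] {k : ℕ} (h : (Fin k → m) → N) (h0 : ∀ f, ¬ Function.Injective f → h f = 0) :
    ∑ f, h f = ∑ g : Fin k ↪o m, ∑ σ : Equiv.Perm (Fin k), h (g ∘ σ) := by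
  rw [← Fintype.sum_prod_type']
  refine (Finset.sum_of_injOn (fun p : (Fin k ↪o m) × Equiv.Perm (Fin k) ↦ p.1 ∘ p.2)
    ?_ (by simp) ?_ fun _ _ ↦ rfl).symm
  · rintro ⟨g, σ⟩ - ⟨g', σ'⟩ - (hgσ : g ∘ σ = g' ∘ σ')
    have hrange : Set.range g = Set.range g' := by
      rw [← σ.surjective.range_comp g, hgσ, σ'.surjective.range_comp]
    have hg : g = g' := DFunLike.coe_injective <|
      (g.strictMono.range_inj g'.strictMono).mp hrange
    subst hg
    exact Prod.ext rfl (Equiv.coe_fn_injective (g.injective.comp_left hgσ))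
  · intro f _ hf
    refine h0 f fun hinj ↦ hf ?_
    have hmono : StrictMono (f ∘ Tuple.sort f) :=
      (Tuple.monotone_sort f).strictMono_of_injective (hinj.comp (Tuple.sort f).injective)
    refine ⟨(OrderEmbedding.ofStrictMono _ hmono, (Tuple.sort f)⁻¹), by simp, ?_⟩
    ext i
    simp

theorem det_mul_eq_sum_prod_mul_det [Fintype m] {k : ℕ} (A : Matrix (Fin k) m R)
    (B : Matrix m (Fin k) R) :
    (A * B).det = ∑ f : Fin k → m, (∏ i, A i (f i)) * (B.submatrix f id).det := by
  classical
  have hrows : A * B = fun i ↦ ∑ j, A i j • B j := by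
    ext i j
    simp [mul_apply]
  change detRowAlternating.toMultilinearMap (A * B) = _
  simp only [hrows, MultilinearMap.map_sum, MultilinearMap.map_smul_univ]
  rfl

theorem compoundMatrix_mul [Preorder l] [Fintype m] [LinearOrder m] [Preorder n] (k : ℕ)
    (A : Matrix l m R) (B : Matrix m n R) :
    compoundMatrix k (A * B) = compoundMatrix k A * compoundMatrix k B := by
  ext r c
  rw [compoundMatrix_apply, submatrix_mul A B r id c Function.bijective_id,
    det_mul_eq_sum_prod_mul_det, sum_eq_sum_orderEmbedding_sum_perm, mul_apply]
  · refine Finset.sum_congr rfl fun g _ ↦ ?_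
    have hperm (σ : Equiv.Perm (Fin k)) : (B.submatrix (g ∘ σ) c).det =
        (Equiv.Perm.sign σ : ℤ) * (B.submatrix g c).det :=
      det_permute σ (B.submatrix g c)
    rw [compoundMatrix_apply, compoundMatrix_apply, ← det_transpose, det_apply', Finset.sum_mul]
    simp only [submatrix_submatrix, Function.id_comp, Function.comp_id, hperm, submatrix_apply,
      transpose_apply, id_eq, Function.comp_apply]
    exact Finset.sum_congr rfl fun σ _ ↦ by ring
  · intro f hf
    obtain ⟨i, j, hij, hne⟩ := Function.not_injective_iff.mp hf
    rw [det_zero_of_row_eq hne (by ext; simp [hij]), mul_zero]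

end CompoundMatrix

section QuadraticForm

open Matrix

variable {F n : Type*} [Field F] [LinearOrder F] [IsStrictOrderedRing F] [Fintype n]

theorem exists_eq_mul_diagonal_mul_transpose {M : Matrix n n F} (hsymm : M.IsSymm)
    (hpsd : ∀ x, 0 ≤ x ⬝ᵥ M *ᵥ x) :
    ∃ (l : ℕ) (P : Matrix n (Fin l) F) (D : Fin l → F),
      (∀ i, 0 ≤ D i) ∧ M = P * diagonal D * Pᵀ := by
  classical
  let B : LinearMap.BilinForm F (n → F) := toBilin' M
  have hB (x y) : B x y = x ⬝ᵥ M *ᵥ y := toBilin'_apply' M x y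
  have hBsymm : LinearMap.IsSymm B := ⟨fun x y ↦ by
    rw [RingHom.id_apply, hB, hB, dotProduct_mulVec, ← mulVec_transpose, hsymm.eq,
      dotProduct_comm]⟩
  have : Invertible (2 : F) := invertibleOfNonzero two_ne_zero
  obtain ⟨v, hv⟩ := LinearMap.BilinForm.exists_orthogonal_basis hBsymm
  have hdiag : LinearMap.BilinForm.toMatrix v B = diagonal fun j ↦ B (v j) (v j) := by
    ext i j
    rw [LinearMap.BilinForm.toMatrix_apply, diagonal_apply]
    split_ifs with hij
    · rw [hij]
    · exact hv hij
  refine ⟨_, (v.toMatrix (Pi.basisFun F n))ᵀ, fun j ↦ B (v j) (v j), fun j ↦ ?_, ?_⟩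
  · simpa only [hB] using hpsd (v j)
  · rw [← hdiag, transpose_transpose, LinearMap.BilinForm.toMatrix_mul_basis_toMatrix,
      LinearMap.BilinForm.toMatrix_basisFun, LinearMap.BilinForm.toMatrix'_toBilin']

theorem dotProduct_compoundMatrix_mulVec_nonneg [Preorder n] {M : Matrix n n F}
    (hsymm : M.IsSymm) (hpsd : ∀ x, 0 ≤ x ⬝ᵥ M *ᵥ x) (k : ℕ) (x : (Fin k ↪o n) → F) :
    0 ≤ x ⬝ᵥ compoundMatrix k M *ᵥ x := by
  obtain ⟨l, P, D, hD, rfl⟩ := exists_eq_mul_diagonal_mul_transpose hsymm hpsd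
  have hdiag (c : Fin k ↪o Fin l) : (x ᵥ* compoundMatrix k (P * diagonal D)) c =
      (∏ i, D (c i)) * (x ᵥ* compoundMatrix k P) c := by
    simp only [vecMul, dotProduct, compoundMatrix_mul_diagonal_apply, Finset.mul_sum,
      mul_left_comm]
  rw [compoundMatrix_mul, compoundMatrix_transpose, ← mulVec_mulVec, dotProduct_mulVec,
    mulVec_transpose]
  refine Finset.sum_nonneg fun c _ ↦ ?_
  rw [hdiag, mul_assoc]
  exact mul_nonneg (Finset.prod_nonneg fun i _ ↦ hD _) (mul_self_nonneg _)

theorem span_range_dotProduct_mulVec_self {R ι : Type*} [CommRing R] [Fintype ι]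
    {N : Matrix ι ι R} (hN : N.IsSymm) (h2 : IsUnit (2 : R)) :
    Ideal.span (Set.range fun x ↦ x ⬝ᵥ N *ᵥ x) = Ideal.span {a | ∃ i j, a = N i j} := by
  classical
  refine le_antisymm (Ideal.span_le.mpr ?_) (Ideal.span_le.mpr ?_)
  · rintro _ ⟨x, rfl⟩
    refine sum_mem fun i _ ↦ Ideal.mul_mem_left _ _ <| sum_mem fun j _ ↦
      Ideal.mul_mem_right _ _ <| Ideal.subset_span ⟨i, j, rfl⟩
  · rintro _ ⟨i, j, rfl⟩
    let q : (ι → R) → R := fun x ↦ x ⬝ᵥ N *ᵥ x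
    have hq (x) : q x ∈ Ideal.span (Set.range q) := Ideal.subset_span ⟨x, rfl⟩
    have hpolar : 2 * N i j = q (Pi.single i 1 + Pi.single j 1) - q (Pi.single i 1) -
        q (Pi.single j 1) := by
      simp only [q, mulVec_add, add_dotProduct, dotProduct_add, mulVec_single_one,
        single_one_dotProduct, col_apply, hN.apply i j]
      ring
    refine (Ideal.unit_mul_mem_iff_mem _ h2).mp ?_
    rw [hpolar]
    exact sub_mem (sub_mem (hq _) (hq _)) (hq _)

end QuadraticForm

section RealSpectrum

variable {A B : Type*} [CommRing A] [CommRing B]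

theorem NonnegOnRealSpectrum.map (f : A →+* B) {a : A} (ha : NonnegOnRealSpectrum a) :
    NonnegOnRealSpectrum (f a) := by
  rintro ⟨P, hP⟩
  let Q : RingPreordering A :=
    { P.toSubsemiring.comap f with
      mem_of_isSquare' := fun hx ↦ P.mem_of_isSquare (hx.map f)
      neg_one_notMem' := fun h ↦ P.neg_one_notMem <| by
        rw [← map_one f, ← map_neg]
        exact h }
  have hQ : Q.IsOrdering := by
    rw [RingPreordering.isOrdering_iff] at hP ⊢
    intro x y (hxy : f (-(x * y)) ∈ P)
    rw [map_neg, map_mul] at hxy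
    exact hP _ _ hxy
  exact ha ⟨Q, hQ⟩

theorem nonnegOnRealSpectrum_of_isSumSq_four_mul {a : A} (ha : IsSumSq (4 * a)) :
    NonnegOnRealSpectrum a := by
  rintro ⟨P, hP⟩
  refine (mem_or_neg_mem P a).elim id fun hneg ↦ ?_
  have h4 : 4 * a ∈ P := RingPreordering.mem_of_isSumSq ha
  have h : 4 * a + (-a + -a + -a) ∈ P := add_mem h4 (add_mem (add_mem hneg hneg) hneg)
  rwa [show 4 * a + (-a + -a + -a) = a by ring] at h

end RealSpectrum

section Minors

open Matrix

variable {A B : Type u} [CommRing A] [CommRing B] {n : ℕ} {M : Matrix (Fin n) (Fin n) A}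

theorem PsdOnRealSpectrum.map (hM : PsdOnRealSpectrum M) (f : A →+* B) :
    PsdOnRealSpectrum (M.map f) :=
  fun R _ _ _ _ φ ↦ hM R (φ.comp f)

theorem minorIdeal_map (f : A →+* B) (k : ℕ) :
    minorIdeal (M.map f) k = (minorIdeal M k).map f := by
  rw [minorIdeal, minorIdeal, Ideal.map_span]
  congr 1
  ext b
  constructor
  · rintro ⟨r, c, rfl⟩
    exact ⟨_, ⟨r, c, rfl⟩, f.map_det _⟩
  · rintro ⟨_, ⟨r, c, rfl⟩, rfl⟩
    exact ⟨r, c, f.map_det _⟩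

theorem PsdOnRealSpectrum.nonnegOnRealClosedFields_compoundMatrix (hM : PsdOnRealSpectrum M)
    (hsymm : M.IsSymm) {k : ℕ} (x : (Fin k ↪o Fin n) → A) :
    NonnegOnRealClosedFields (x ⬝ᵥ compoundMatrix k M *ᵥ x) := by
  intro R _ _ _ _ φ
  have h := dotProduct_compoundMatrix_mulVec_nonneg (hsymm.map φ) (hM R φ) k (φ ∘ x)
  have hφ : φ ∘ (compoundMatrix k M *ᵥ x) = (compoundMatrix k M).map φ *ᵥ (φ ∘ x) :=
    funext (φ.map_mulVec _ x)
  rwa [φ.map_dotProduct, hφ, ← compoundMatrix_map]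

end Minors

section LocalRing

open IsLocalRing

theorem exists_mem_associated_of_span_eq_span_singleton {B : Type*} [CommRing B]
    [IsLocalRing B] {S : Set B} (hS : S.Nonempty) {d : B} (h : Ideal.span S = Ideal.span {d}) :
    ∃ s ∈ S, Associated d s := by
  have hdvd {s : B} (hs : s ∈ S) : d ∣ s :=
    Ideal.mem_span_singleton.mp (h ▸ Ideal.subset_span hs)
  by_contra! hna
  have hle : Ideal.span {d} ≤ maximalIdeal B • Ideal.span {d} := by
    conv_lhs => rw [← h]
    refine Ideal.span_le.mpr fun s hs ↦ ?_
    obtain ⟨b, rfl⟩ := hdvd hs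
    rw [mul_comm]
    refine Ideal.mul_mem_mul (fun hb ↦ hna _ hs ?_) (Ideal.mem_span_singleton_self d)
    exact associated_mul_unit_right d b hb
  have hbot : Ideal.span {d} = ⊥ := Submodule.eq_bot_of_le_smul_of_le_jacobson_bot _ _
    (Submodule.fg_span_singleton d) hle (maximalIdeal_le_jacobson ⊥)
  obtain ⟨s, hs⟩ := hS
  obtain rfl : d = 0 := Ideal.span_singleton_eq_bot.mp hbot
  exact hna s hs (zero_dvd_iff.mp (hdvd hs) ▸ .refl _)

theorem exists_associated_mul_self_of_minorIdeal_eq {B : Type u} [CommRing B] [IsDomain B]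
    [ValuationRing B] [IsSemireal (ResidueField B)] {n : ℕ} {M : Matrix (Fin n) (Fin n) B}
    (hsymm : M.IsSymm) (hM : PsdOnRealSpectrum M) {k : ℕ} {d : B}
    (hd : minorIdeal M k = Ideal.span {d}) : ∃ c : B, Associated d (c * c) := by
  have hC : (compoundMatrix k M).IsSymm := by
    rw [Matrix.IsSymm, ← compoundMatrix_transpose, hsymm.eq]
  have hspan := (span_range_dotProduct_mulVec_self hC isUnit_two).trans hd
  obtain ⟨_, ⟨x, rfl⟩, hdx⟩ :=
    exists_mem_associated_of_span_eq_span_singleton (Set.range_nonempty _) hspan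
  obtain ⟨c, hc⟩ :=
    (hM.nonnegOnRealClosedFields_compoundMatrix hsymm x).exists_associated_mul_self
  exact ⟨c, hdx.trans hc⟩

end LocalRing

section NonrealResidueField

open IsLocalRing

theorem exists_mul_self_mul_eq_algebraMap_of_isSumSq {A S : Type*} [CommRing A] [CommRing S]
    [Algebra A S] (T : Submonoid A) [IsLocalization T S] {y : S} (hy : IsSumSq y) :
    ∃ c ∈ T, ∃ t, IsSumSq t ∧ algebraMap A S (c * c) * y = algebraMap A S t := by
  induction hy with
  | zero => exact ⟨1, T.one_mem, 0, .zero, by simp⟩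
  | sq_add a _ ih =>
    obtain ⟨c, hc, t, ht, h⟩ := ih
    obtain ⟨⟨p, q⟩, hpq⟩ := IsLocalization.surj T a
    refine ⟨c * q, T.mul_mem hc q.2, c * p * (c * p) + q * q * t,
      ((IsSumSq.mul_self _).mul ht).sq_add _, ?_⟩
    simp only [map_add, map_mul] at h ⊢
    rw [← hpq]
    linear_combination algebraMap A S q * algebraMap A S q * h

theorem exists_mul_self_add_pow_eq {A : Type*} [CommRing A] {t : A} (ht : IsSumSq t) (c : A)
    (N : ℕ) : ∃ s, IsSumSq s ∧ (c * c + t) ^ N = c ^ N * c ^ N + s := by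
  induction N with
  | zero => exact ⟨0, .zero, by simp⟩
  | succ N ih =>
    obtain ⟨s, hs, h⟩ := ih
    refine ⟨c ^ N * c ^ N * t + s * (c * c + t),
      ((IsSumSq.mul_self _).mul ht).add (hs.mul (ht.sq_add c)), ?_⟩
    rw [pow_succ, h]
    ring

theorem exists_dvd_pow_of_mem_maximalIdeal {B : Type*} [CommRing B] [IsLocalRing B]
    [Ring.DimensionLEOne B] {x z : B} (hx : x ≠ 0) (hz : z ∈ maximalIdeal B) :
    ∃ N, x ∣ z ^ N := by
  suffices h : z ∈ (Ideal.span {x}).radical by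
    simpa only [Ideal.mem_radical_iff, Ideal.mem_span_singleton] using h
  rw [Ideal.radical_eq_sInf, Ideal.mem_sInf]
  rintro P ⟨hxP, hP⟩
  have hP0 : P ≠ ⊥ := by
    rintro rfl
    exact hx ((Ideal.span_singleton_le_iff_mem _).mp hxP)
  rwa [eq_maximalIdeal (hP.isMaximal hP0)]

variable {A : Type*} [CommRing A] {𝔭 : Ideal A} [𝔭.IsPrime]

local notation "A𝔭" => Localization.AtPrime 𝔭

theorem exists_mul_self_add_mem_of_not_isSemireal (h : ¬ IsSemireal (ResidueField A𝔭)) :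
    ∃ c ∉ 𝔭, ∃ t, IsSumSq t ∧ c * c + t ∈ 𝔭 := by
  rw [isSemireal_iff_not_isSumSq_neg_one, not_not] at h
  obtain ⟨y, hy, hy1⟩ := exists_isSumSq_of_surjective (residue_surjective (R := A𝔭)) h
  obtain ⟨c, hc, t, ht, hct⟩ := exists_mul_self_mul_eq_algebraMap_of_isSumSq 𝔭.primeCompl hy
  refine ⟨c, hc, t, ht, ?_⟩
  rw [← IsLocalization.AtPrime.to_map_mem_maximal_iff A𝔭 𝔭, ← residue_eq_zero_iff, map_add, ← hct,
    map_add, map_mul _ _ y, hy1]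
  ring

theorem exists_mul_self_add_eq_mul_of_not_isSemireal [Ring.DimensionLEOne A𝔭]
    (h : ¬ IsSemireal (ResidueField A𝔭)) {x : A𝔭} (hx : x ≠ 0) :
    ∃ c ∉ 𝔭, ∃ t, IsSumSq t ∧
      ∃ z ∈ maximalIdeal A𝔭, algebraMap A A𝔭 (c * c + t) = x * z := by
  obtain ⟨c, hc, t, ht, hct⟩ := exists_mul_self_add_mem_of_not_isSemireal h
  have hmem := (IsLocalization.AtPrime.to_map_mem_maximal_iff A𝔭 𝔭 _).mpr hct
  obtain ⟨N, y, hy⟩ := exists_dvd_pow_of_mem_maximalIdeal hx hmem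
  obtain ⟨s, hs, hpow⟩ := exists_mul_self_add_pow_eq ht c (N + 1)
  refine ⟨c ^ (N + 1), fun hcN ↦ hc (Ideal.IsPrime.mem_of_pow_mem ‹_› _ hcN), s, hs,
    y * algebraMap A A𝔭 (c * c + t), Ideal.mul_mem_left _ y hmem, ?_⟩
  rw [← hpow, map_pow, pow_succ, hy, mul_assoc]

theorem exists_nonnegOnRealSpectrum_associated_of_not_isSemireal
    [Ring.DimensionLEOne A𝔭] (h : ¬ IsSemireal (ResidueField A𝔭)) (x : A) :
    ∃ f, NonnegOnRealSpectrum f ∧ Associated (algebraMap A A𝔭 x) (algebraMap A A𝔭 f) := by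
  by_cases hx : algebraMap A A𝔭 x = 0
  · exact ⟨0, fun α ↦ zero_mem α.1, by rw [hx, map_zero]⟩
  obtain ⟨c, hc, t, ht, z, hz, hcz⟩ := exists_mul_self_add_eq_mul_of_not_isSemireal h hx
  -- `f = c² x + (c² + t)(x² + 1)` is `x` times a unit since `x 𝔪` contains `c² + t`, and it is
  -- nonnegative since `f = c² (x² + x + 1) + t (x² + 1)`.
  refine ⟨c * c * x + (c * c + t) * (x * x + 1), nonnegOnRealSpectrum_of_isSumSq_four_mul ?_, ?_⟩
  · have hsq : 4 * (c * c * x + (c * c + t) * (x * x + 1)) =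
        c * c * ((2 * x + 1) * (2 * x + 1) + (3 : ℕ)) + (4 : ℕ) * (t * (x * x + 1)) := by
      push_cast
      ring
    rw [hsq]
    exact ((IsSumSq.mul_self c).mul ((IsSumSq.natCast 3).sq_add _)).add
      ((IsSumSq.natCast 4).mul (ht.mul (IsSumSq.one.sq_add x)))
  · have hunit : IsUnit (algebraMap A A𝔭 (c * c) + z * algebraMap A A𝔭 (x * x + 1)) := by
      rw [← residue_ne_zero_iff_isUnit, map_add, map_mul _ z, (residue_eq_zero_iff z).mpr hz,
        zero_mul, add_zero, residue_ne_zero_iff_isUnit]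
      exact IsLocalization.map_units A𝔭 (⟨c, hc⟩ * ⟨c, hc⟩ : 𝔭.primeCompl)
    refine ⟨hunit.unit, ?_⟩
    rw [IsUnit.unit_spec, map_add _ (c * c * x), map_mul _ (c * c) x, map_mul _ (c * c + t), hcz]
    ring

end NonrealResidueField

theorem exists_associated_algebraMap {A : Type*} [CommRing A] (T : Submonoid A) {S : Type*}
    [CommRing S] [Algebra A S] [IsLocalization T S] (y : S) :
    ∃ x : A, Associated y (algebraMap A S x) := by
  obtain ⟨⟨x, s⟩, hxs⟩ := IsLocalization.surj T y
  exact ⟨x, (IsLocalization.map_units S s).unit, hxs⟩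

theorem valuationRing_atPrime {A : Type*} [CommRing A] [IsDedekindDomain A] (𝔭 : Ideal A)
    [𝔭.IsPrime] : ValuationRing (Localization.AtPrime 𝔭) := by
  have : IsDedekindDomain (Localization.AtPrime 𝔭) :=
    IsLocalization.AtPrime.isDedekindDomain A 𝔭 _
  exact ((tfae_of_isNoetherianRing_of_isLocalRing_of_isDomain _).out 2 1).mp this

theorem mainTheorem3_general {A : Type*} [CommRing A] (𝔭 : Ideal A) [𝔭.IsPrime]
    [IsDomain (Localization.AtPrime 𝔭)] [ValuationRing (Localization.AtPrime 𝔭)]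
    [Ring.DimensionLEOne (Localization.AtPrime 𝔭)] {n : ℕ} (M : Matrix (Fin n) (Fin n) A)
    (hsymm : M.IsSymm) (hpsd : PsdOnRealSpectrum M) (k : ℕ) (d : A)
    (hd : minorIdeal M k = Ideal.span {d}) :
    ∃ d' : Localization.AtPrime 𝔭,
      Associated (algebraMap A (Localization.AtPrime 𝔭) d) d' ∧
      NonnegOnRealSpectrum d' ∧
      ∃ a : A, algebraMap A (Localization.AtPrime 𝔭) a = d' ∧ NonnegOnRealSpectrum a := by
  suffices h : ∃ a : A, NonnegOnRealSpectrum a ∧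
      Associated (algebraMap A (Localization.AtPrime 𝔭) d) (algebraMap A _ a) by
    obtain ⟨a, ha, hda⟩ := h
    exact ⟨_, hda, ha.map _, a, rfl, ha⟩
  by_cases hreal : IsSemireal (IsLocalRing.ResidueField (Localization.AtPrime 𝔭))
  · let f := algebraMap A (Localization.AtPrime 𝔭)
    have hd' : minorIdeal (M.map f) k = Ideal.span {f d} := by
      rw [minorIdeal_map, hd, Ideal.map_span, Set.image_singleton]
    obtain ⟨c, hc⟩ := exists_associated_mul_self_of_minorIdeal_eq (hsymm.map f) (hpsd.map f) hd'
    obtain ⟨a, ha⟩ := exists_associated_algebraMap 𝔭.primeCompl c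
    refine ⟨a * a, fun α ↦ RingPreordering.mem_of_isSumSq (.mul_self a), ?_⟩
    rw [map_mul]
    exact hc.trans (ha.mul_mul ha)
  · exact exists_nonnegOnRealSpectrum_associated_of_not_isSemireal hreal d

theorem mainTheorem3 {A : Type*} [CommRing A] [IsDedekindDomain A] (hA : PNRI A)
    {n : ℕ} (M : Matrix (Fin n) (Fin n) A) (hsymm : M.IsSymm) (hpsd : PsdOnRealSpectrum M)
    (d : ℕ → A) (hd : ∀ k : ℕ, 1 ≤ k → k ≤ n → minorIdeal M k = Ideal.span {d k})
    (𝔭 : Ideal A) [𝔭.IsPrime] (k : ℕ) (hk : 1 ≤ k) (hkn : k ≤ n) :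
    ∃ d' : Localization.AtPrime 𝔭,
      Associated (algebraMap A (Localization.AtPrime 𝔭) (d k)) d' ∧
      NonnegOnRealSpectrum d' ∧
      ∃ a : A, algebraMap A (Localization.AtPrime 𝔭) a = d' ∧ NonnegOnRealSpectrum a := by
  have := valuationRing_atPrime 𝔭
  have := IsLocalization.AtPrime.isDedekindDomain A 𝔭 (Localization.AtPrime 𝔭)
  exact mainTheorem3_general 𝔭 M hsymm hpsd k (d k) (hd k hk hkn)
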